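/- Let $p = p(n) \in [0,1]$ satisfy $p(n)\big/\frac{\log n}{n} \to \infty$ as $n \to \infty$ and $p(n) \le \frac{(\log n)^{10}}{n}$ for all sufficiently large $n$, where $\log$ is the natural logarithm. Let $G(n,p)$ be the random graph on $n$ vertices in which each pair of distinct vertices is an edge independently with probability $p$. Then there is a function $\varepsilon(n) = o(n)$ such that, with probability tending to $1$ as $n \to \infty$, the graph $G \sim G(n,p)$ has the following property: for every set $S$ of vertices of even cardinality there is a set $E_0$ of edges of $G$ such that $S$ is exactly the set of vertices incident to an odd number of edges in $E_0$, and $$\left| |E_0| - \frac{|S|}{2} \right| \le \varepsilon(n).$$ -/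

import Mathlib

open Filter Topology Asymptotics

/-- The set of vertices incident to an odd number of edges of the edge set `E`. -/
def oddVertices {V : Type*} [Fintype V] [DecidableEq V] (E : Finset (Sym2 V)) : Finset V :=
  Finset.univ.filter fun v => Odd (E.filter fun e => v ∈ e).card

/-- With high probability: the random graph `G(n, p n)` on the vertex set `Fin n`, where each of
the pairs of distinct vertices is an edge independently with probability `p n`, satisfies the
property `P n` with probability tending to `1` as `n → ∞`. -/
def HoldsWhp (p : ℕ → unitInterval) (P : (n : ℕ) → SimpleGraph (Fin n) → Prop) : Prop :=
  Tendsto (fun n => SimpleGraph.binomialRandom (Fin n) (p n) {G | P n G}) atTop (𝓝 1)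

/-!
Fix `m = O(log n / p)`, which is `o(n)` because `p ≫ log n / n`. A union bound shows that with high
probability `G = G(n, p)` has the following two properties: any two disjoint sets of `m` vertices
are joined by an edge, and the closed neighbourhood of every set `A` with `|A| ≤ m` has at least
`2 |A|` vertices. If one of them fails, some two disjoint sets have no edge
between them (`binomialRandom_exists_isEmptyPair_scale_le`), and each union-bound term is at most `n⁻²`.

In such a graph a set `S` of `2 j` vertices is paired up greedily. Split `S` into two halves and let
each grow by passing to closed neighbourhoods. After `k` steps, where `2 ^ k * j ≥ m`, both have
`m` vertices, so they meet or are joined by an edge. Hence some `a` and `c` in different halves are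
joined by at most `2 k + 1` edges. Remove `a` and `c` and recurse, adding up the edge sets mod 2
(`exists_oddVertices_eq_of_expansion`).

The total is at most `|S| / 2 + 2 ∑ k(j)`, where `k(j)` is about `log₂ (m / j)` for `j < m` and is
`0` afterwards. This sum is `O(m)`, with no logarithmic factor (`sum_doublingTime_le`), so the
excess over `|S| / 2` is `O(m) = o(n)`. Conversely `|S| / 2` edges are always needed, since an edge
changes the parity of two vertices.
-/

/-! ### The parity boundary of an edge set -/

section Parity

lemma card_symmDiff_le {α : Type*} [DecidableEq α] (E F : Finset α) :
    (symmDiff E F).card ≤ E.card + F.card :=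
  (Finset.card_le_card (Finset.union_subset_union Finset.sdiff_subset Finset.sdiff_subset)).trans
    (Finset.card_union_le E F)

lemma coe_symmDiff_subset_edgeSet {V : Type*} [DecidableEq V] {G : SimpleGraph V} {E F : Finset (Sym2 V)}
    (hE : (E : Set (Sym2 V)) ⊆ G.edgeSet)
    (hF : (F : Set (Sym2 V)) ⊆ G.edgeSet) :
    ((symmDiff E F : Finset (Sym2 V)) : Set (Sym2 V)) ⊆ G.edgeSet := by
  intro e he
  rcases Finset.mem_symmDiff.1 (Finset.mem_coe.1 he) with h | h
  · exact hE h.1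
  · exact hF h.1

variable {V : Type*} [Fintype V] [DecidableEq V]

lemma mem_oddVertices {E : Finset (Sym2 V)} {v : V} :
    v ∈ oddVertices E ↔ Odd (E.filter fun e => v ∈ e).card := by
  simp [oddVertices]

lemma oddVertices_empty : oddVertices (∅ : Finset (Sym2 V)) = ∅ := by
  ext v; simp [mem_oddVertices]

lemma oddVertices_symmDiff (E F : Finset (Sym2 V)) :
    oddVertices (symmDiff E F) = symmDiff (oddVertices E) (oddVertices F) := by
  ext v
  have hfilter : (symmDiff E F).filter (fun e => v ∈ e)
      = symmDiff (E.filter fun e => v ∈ e) (F.filter fun e => v ∈ e) := by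
    ext e
    simp only [Finset.mem_filter, Finset.mem_symmDiff]
    tauto
  rw [Finset.mem_symmDiff, mem_oddVertices, mem_oddVertices, mem_oddVertices, hfilter]
  generalize (E.filter fun e => v ∈ e) = A
  generalize (F.filter fun e => v ∈ e) = B
  have hcard : (symmDiff A B).card = (A \ B).card + (B \ A).card :=
    Finset.card_union_of_disjoint disjoint_sdiff_sdiff
  have hA := Finset.card_sdiff_add_card_inter A B
  have hB := Finset.card_sdiff_add_card_inter B A
  rw [Finset.inter_comm] at hB
  simp only [Nat.odd_iff]
  omega

lemma oddVertices_singleton_mk {u v : V} (h : u ≠ v) :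
    oddVertices {s(u, v)} = symmDiff {u} {v} := by
  ext w
  rw [mem_oddVertices, Finset.filter_singleton, Finset.mem_symmDiff]
  by_cases hu : w = u <;> by_cases hv : w = v <;> simp_all

/-- Each edge changes the parity of at most two vertices. -/
lemma card_oddVertices_le (E : Finset (Sym2 V)) : (oddVertices E).card ≤ 2 * E.card := by
  have hsub : oddVertices E ⊆ E.biUnion Sym2.toFinset := by
    intro v hv
    obtain ⟨e, he⟩ := Finset.card_pos.1 (mem_oddVertices.1 hv).pos
    rw [Finset.mem_filter] at he
    exact Finset.mem_biUnion.2 ⟨e, he.1, Sym2.mem_toFinset.2 he.2⟩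
  calc (oddVertices E).card ≤ (E.biUnion Sym2.toFinset).card := Finset.card_le_card hsub
    _ ≤ E.card * 2 := Finset.card_biUnion_le_card_mul _ _ _ fun e _ => by
        rw [Sym2.card_toFinset]; split_ifs <;> omega
    _ = 2 * E.card := mul_comm _ _

/-! ### Short joins of two vertices -/

/-- `u` and `v` are joined by at most `L` edges of `G`: some set of at most `L` edges has odd
degree exactly at `u` and `v` (at no vertex if `u = v`). Edge sets of walks are of this kind once
repeated edges are cancelled mod 2. -/
def JoinedBy (G : SimpleGraph V) (L : ℕ) (u v : V) : Prop :=
  ∃ E : Finset (Sym2 V), (E : Set (Sym2 V)) ⊆ G.edgeSet ∧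
    oddVertices E = symmDiff {u} {v} ∧ E.card ≤ L

variable {G : SimpleGraph V}

lemma JoinedBy.refl (u : V) : JoinedBy G 0 u u :=
  ⟨∅, by simp, by simp [oddVertices_empty], by simp⟩

lemma JoinedBy.of_adj {u v : V} (h : G.Adj u v) : JoinedBy G 1 u v :=
  ⟨{s(u, v)}, by simpa using h, oddVertices_singleton_mk h.ne, by simp⟩

lemma JoinedBy.mono {L L' : ℕ} {u v : V} (h : JoinedBy G L u v) (hL : L ≤ L') :
    JoinedBy G L' u v :=
  let ⟨E, hE, hodd, hcard⟩ := h
  ⟨E, hE, hodd, hcard.trans hL⟩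

lemma JoinedBy.symm {L : ℕ} {u v : V} (h : JoinedBy G L u v) : JoinedBy G L v u :=
  let ⟨E, hE, hodd, hcard⟩ := h
  ⟨E, hE, hodd.trans (symmDiff_comm _ _), hcard⟩

lemma JoinedBy.trans {L L' : ℕ} {u v w : V} (h : JoinedBy G L u v) (h' : JoinedBy G L' v w) :
    JoinedBy G (L + L') u w := by
  obtain ⟨E, hE, hEodd, hEcard⟩ := h
  obtain ⟨F, hF, hFodd, hFcard⟩ := h'
  refine ⟨symmDiff E F, coe_symmDiff_subset_edgeSet hE hF, ?_,
    (card_symmDiff_le E F).trans (add_le_add hEcard hFcard)⟩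
  rw [oddVertices_symmDiff, hEodd, hFodd, symmDiff_assoc, symmDiff_symmDiff_cancel_left]

/-! ### Expansion -/

open Classical in
/-- The closed neighbourhood of a vertex set: its vertices and all their neighbours. -/
noncomputable def closedNeighborhood (G : SimpleGraph V) (A : Finset V) : Finset V :=
  Finset.univ.filter fun v => v ∈ A ∨ ∃ u ∈ A, G.Adj u v

lemma mem_closedNeighborhood {A : Finset V} {v : V} :
    v ∈ closedNeighborhood G A ↔ v ∈ A ∨ ∃ u ∈ A, G.Adj u v := by
  simp [closedNeighborhood]

lemma subset_closedNeighborhood (A : Finset V) : A ⊆ closedNeighborhood G A :=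
  fun _ hv => mem_closedNeighborhood.2 (Or.inl hv)

lemma exists_joinedBy_of_mem_iterate (A : Finset V) (k : ℕ) :
    ∀ v ∈ (closedNeighborhood G)^[k] A, ∃ u ∈ A, JoinedBy G k u v := by
  induction k with
  | zero => exact fun v hv => ⟨v, hv, JoinedBy.refl v⟩
  | succ k ih =>
    intro v hv
    rw [Function.iterate_succ_apply', mem_closedNeighborhood] at hv
    rcases hv with hv | ⟨w, hw, hwv⟩
    · obtain ⟨u, hu, huv⟩ := ih v hv
      exact ⟨u, hu, huv.mono k.le_succ⟩
    · obtain ⟨u, hu, huw⟩ := ih w hw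
      exact ⟨u, hu, huw.trans (JoinedBy.of_adj hwv)⟩

/-- If closed neighbourhoods of sets of at most `m` vertices double in size, balls grow
exponentially until they have `m` vertices. -/
lemma min_le_card_iterate_closedNeighborhood {m : ℕ}
    (hexp : ∀ A : Finset V, A.card ≤ m → 2 * A.card ≤ (closedNeighborhood G A).card)
    (A : Finset V) (k : ℕ) :
    min m (2 ^ k * A.card) ≤ ((closedNeighborhood G)^[k] A).card := by
  induction k with
  | zero => simp
  | succ k ih =>
    rw [Function.iterate_succ_apply']
    set B := (closedNeighborhood G)^[k] A
    rcases le_total B.card m with hB | hB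
    · have := hexp B hB
      have hpow : 2 ^ (k + 1) * A.card = 2 * (2 ^ k * A.card) := by ring
      omega
    · exact (min_le_left _ _).trans
        (hB.trans (Finset.card_le_card (subset_closedNeighborhood B)))

lemma exists_joinedBy_of_expansion {m : ℕ}
    (hexp : ∀ A : Finset V, A.card ≤ m → 2 * A.card ≤ (closedNeighborhood G A).card)
    (hedge : ∀ A C : Finset V, A.card = m → C.card = m → Disjoint A C →
      ∃ a ∈ A, ∃ c ∈ C, G.Adj a c)
    {A C : Finset V} {k : ℕ} (hA : m ≤ 2 ^ k * A.card) (hC : m ≤ 2 ^ k * C.card) :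
    ∃ a ∈ A, ∃ c ∈ C, JoinedBy G (2 * k + 1) a c := by
  have hA' := min_le_card_iterate_closedNeighborhood hexp A k
  have hC' := min_le_card_iterate_closedNeighborhood hexp C k
  rw [min_eq_left hA] at hA'
  rw [min_eq_left hC] at hC'
  obtain ⟨A', hAsub, hAcard⟩ := Finset.exists_subset_card_eq hA'
  obtain ⟨C', hCsub, hCcard⟩ := Finset.exists_subset_card_eq hC'
  by_cases hdisj : Disjoint A' C'
  · obtain ⟨x, hx, y, hy, hxy⟩ := hedge A' C' hAcard hCcard hdisj
    obtain ⟨a, ha, hax⟩ := exists_joinedBy_of_mem_iterate A k x (hAsub hx)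
    obtain ⟨c, hc, hcy⟩ := exists_joinedBy_of_mem_iterate C k y (hCsub hy)
    exact ⟨a, ha, c, hc, ((hax.trans (JoinedBy.of_adj hxy)).trans hcy.symm).mono (by omega)⟩
  · obtain ⟨x, hx, hx'⟩ := Finset.not_disjoint_iff.1 hdisj
    obtain ⟨a, ha, hax⟩ := exists_joinedBy_of_mem_iterate A k x (hAsub hx)
    obtain ⟨c, hc, hcx⟩ := exists_joinedBy_of_mem_iterate C k x (hCsub hx')
    exact ⟨a, ha, c, hc, (hax.trans hcx.symm).mono (by omega)⟩

end Parity

/-! ### Greedy pairing -/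

/-- The number of doublings after which `j` reaches `m` (for `0 < j`), written as a count of the
`t` with `2 ^ t * j < m` so that it can be summed over `j` by exchanging the order of summation. -/
def doublingTime (m j : ℕ) : ℕ :=
  ((Finset.range m).filter fun t => 2 ^ t * j < m).card

lemma le_two_pow_doublingTime_mul {m j : ℕ} (hj : 0 < j) : m ≤ 2 ^ doublingTime m j * j := by
  by_contra! h
  have hsub : Finset.range (doublingTime m j + 1) ⊆
      (Finset.range m).filter fun t => 2 ^ t * j < m := by
    intro t ht
    have hle : t ≤ doublingTime m j := Nat.lt_succ_iff.1 (Finset.mem_range.1 ht)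
    have hlt : 2 ^ t * j < m :=
      (Nat.mul_le_mul_right j (Nat.pow_le_pow_right two_pos hle)).trans_lt h
    refine Finset.mem_filter.2 ⟨Finset.mem_range.2 ?_, hlt⟩
    calc t < 2 ^ t := Nat.lt_two_pow_self
      _ ≤ 2 ^ t * j := Nat.le_mul_of_pos_right _ hj
      _ < m := hlt
  have := Finset.card_le_card hsub
  rw [Finset.card_range] at this
  exact absurd this (by simp [doublingTime])

/-- The doubling times sum to `O(m)`, not `O(m log m)`: time `t` or more is needed only for
`j < m / 2 ^ (t - 1)`. -/
lemma sum_doublingTime_le (m J : ℕ) : ∑ j ∈ Finset.Icc 1 J, doublingTime m j ≤ 2 * m := by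
  calc ∑ j ∈ Finset.Icc 1 J, doublingTime m j
      = ∑ t ∈ Finset.range m, ((Finset.Icc 1 J).filter fun j => 2 ^ t * j < m).card := by
        simp only [doublingTime, Finset.card_filter]
        exact Finset.sum_comm
    _ ≤ ∑ t ∈ Finset.range m, m / 2 ^ t := by
        refine Finset.sum_le_sum fun t _ => ?_
        calc _ ≤ (Finset.Icc 1 (m / 2 ^ t)).card := by
              refine Finset.card_le_card fun j hj => ?_
              rw [Finset.mem_filter, Finset.mem_Icc] at hj
              rw [Finset.mem_Icc, Nat.le_div_iff_mul_le (by positivity), mul_comm]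
              exact ⟨hj.1.1, hj.2.le⟩
          _ = m / 2 ^ t := by simp
    _ ≤ m * 2 / (2 - 1) := Nat.geom_sum_le le_rfl _ _
    _ = 2 * m := by simp [mul_comm]

section Greedy

variable {V : Type*} [Fintype V] [DecidableEq V] {G : SimpleGraph V}

/-- Split `S` into halves, join a vertex of one half to a vertex of the other by few edges, and
recurse on the remaining vertices. -/
lemma exists_oddVertices_eq_of_expansion {m : ℕ}
    (hexp : ∀ A : Finset V, A.card ≤ m → 2 * A.card ≤ (closedNeighborhood G A).card)
    (hedge : ∀ A C : Finset V, A.card = m → C.card = m → Disjoint A C →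
      ∃ a ∈ A, ∃ c ∈ C, G.Adj a c) (j : ℕ) :
    ∀ S : Finset V, S.card = 2 * j → ∃ E : Finset (Sym2 V), (E : Set (Sym2 V)) ⊆ G.edgeSet ∧
      oddVertices E = S ∧ E.card ≤ j + 2 * ∑ i ∈ Finset.Icc 1 j, doublingTime m i := by
  induction j with
  | zero =>
    intro S hS
    exact ⟨∅, by simp, by rw [oddVertices_empty, Finset.card_eq_zero.1 hS],
      by simp⟩
  | succ j ih =>
    intro S hS
    obtain ⟨A, hAS, hA⟩ := Finset.exists_subset_card_eq (show j + 1 ≤ S.card by omega)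
    have hC : (S \ A).card = j + 1 := by
      rw [Finset.card_sdiff_of_subset hAS]; omega
    have htime := le_two_pow_doublingTime_mul (m := m) (Nat.succ_pos j)
    obtain ⟨a, ha, c, hc, E, hE, hEodd, hEcard⟩ := exists_joinedBy_of_expansion hexp hedge
      (A := A) (C := S \ A) (k := doublingTime m (j + 1)) (by rwa [hA]) (by rwa [hC])
    obtain ⟨hcS, hcA⟩ := Finset.mem_sdiff.1 hc
    have hac : a ≠ c := fun h => hcA (h ▸ ha)
    have hpair : symmDiff {a} {c} = ({a, c} : Finset V) := by
      ext x
      simp only [Finset.mem_symmDiff, Finset.mem_singleton, Finset.mem_insert]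
      constructor
      · tauto
      · rintro (rfl | rfl)
        · exact Or.inl ⟨rfl, hac⟩
        · exact Or.inr ⟨rfl, hac.symm⟩
    have hsub : ({a, c} : Finset V) ⊆ S := by
      simp [Finset.insert_subset_iff, hAS ha, hcS]
    obtain ⟨F, hF, hFodd, hFcard⟩ := ih (S \ {a, c}) (by
      rw [Finset.card_sdiff_of_subset hsub, Finset.card_pair hac]; omega)
    refine ⟨symmDiff F E, coe_symmDiff_subset_edgeSet hF hE, ?_, ?_⟩
    · rw [oddVertices_symmDiff, hFodd, hEodd, hpair, disjoint_sdiff_self_left.symmDiff_eq_sup]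
      exact Finset.sdiff_union_of_subset hsub
    · rw [Finset.sum_Icc_succ_top (by omega)]
      have := card_symmDiff_le F E
      omega

/-- In a graph with sufficient expansion at scale `m`, every even vertex set `S` is the parity
boundary of `|S| / 2 + O(m)` edges. -/
lemma exists_abs_card_sub_le_of_expansion {m : ℕ}
    (hexp : ∀ A : Finset V, A.card ≤ m → 2 * A.card ≤ (closedNeighborhood G A).card)
    (hedge : ∀ A C : Finset V, A.card = m → C.card = m → Disjoint A C →
      ∃ a ∈ A, ∃ c ∈ C, G.Adj a c) (S : Finset V) (hS : Even S.card) :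
    ∃ E : Finset (Sym2 V), (E : Set (Sym2 V)) ⊆ G.edgeSet ∧
      oddVertices E = S ∧ |(E.card : ℝ) - (S.card : ℝ) / 2| ≤ 4 * m := by
  obtain ⟨j, hj⟩ := hS
  obtain ⟨E, hE, hodd, hcard⟩ := exists_oddVertices_eq_of_expansion hexp hedge j S (by omega)
  refine ⟨E, hE, hodd, ?_⟩
  have hle : E.card ≤ j + 4 * m := by
    have := sum_doublingTime_le m j
    omega
  have hge : j ≤ E.card := by
    have := card_oddVertices_le E
    rw [hodd] at this
    omega
  have hle' : (E.card : ℝ) ≤ j + 4 * m := by exact_mod_cast hle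
  have hge' : (j : ℝ) ≤ E.card := by exact_mod_cast hge
  have hj' : (S.card : ℝ) = j + j := by exact_mod_cast hj
  rw [abs_le]
  constructor <;> linarith [(Nat.cast_nonneg m : (0 : ℝ) ≤ m)]

end Greedy

/-! ### Pairs of vertex sets without edges between them -/

section Probability

open MeasureTheory ProbabilityTheory

/-- `A` and `C` are disjoint and `G` has no edge between them. -/
def IsEmptyPair {V : Type*} (G : SimpleGraph V) (A C : Finset V) : Prop :=
  Disjoint A C ∧ ∀ a ∈ A, ∀ c ∈ C, ¬ G.Adj a c

lemma setBernoulli_disjoint_le {ι : Type*} [Countable ι] (u : Set ι) (p : unitInterval)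
    (T : Finset ι) (hT : (T : Set ι) ⊆ u) :
    setBernoulli u p {s | ∀ i ∈ T, i ∉ s} ≤ ENNReal.ofReal ((1 - p : ℝ) ^ T.card) := by
  classical
  rw [setBernoulli_apply']
  have hpre : (fun q : ι → Prop => {i | q i}) ⁻¹' {s | ∀ i ∈ T, i ∉ s}
      = Set.pi (T : Set ι) fun _ => {False} := by
    ext q; simp [Set.mem_pi]
  rw [hpre, Measure.infinitePi_pi _ (fun _ _ => MeasurableSet.of_discrete)]
  rw [Finset.prod_congr rfl (g := fun _ => ENNReal.ofReal (1 - p : ℝ)), Finset.prod_const,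
    ENNReal.ofReal_pow (sub_nonneg.2 p.2.2)]
  intro i hi
  have hi' : i ∈ u := hT hi
  have hsymm : (unitInterval.toNNReal (unitInterval.symm p) : ENNReal)
      = ENNReal.ofReal (1 - p : ℝ) := by
    rw [← unitInterval.coe_symm_eq, ← unitInterval.coe_toNNReal, ENNReal.ofReal_coe_nnreal]
  simp [hi', hsymm]

lemma binomialRandom_isEmptyPair_le {V : Type*} [Finite V] (p : unitInterval) (A C : Finset V) :
    SimpleGraph.binomialRandom V p {G | IsEmptyPair G A C}
      ≤ ENNReal.ofReal ((1 - p : ℝ) ^ (A.card * C.card)) := by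
  classical
  by_cases hdisj : Disjoint A C
  swap
  · simp [IsEmptyPair, hdisj]
  have hne : ∀ a ∈ A, ∀ c ∈ C, a ≠ c := fun a ha c hc h =>
    Finset.disjoint_left.1 hdisj ha (h ▸ hc)
  set T : Finset (Sym2 V) := (A ×ˢ C).image fun x => s(x.1, x.2) with hTdef
  have hTcard : T.card = A.card * C.card := by
    rw [hTdef, Finset.card_image_of_injOn, Finset.card_product]
    rintro ⟨a, c⟩ hac ⟨a', c'⟩ hac' h
    simp only [Finset.coe_product, Set.mem_prod, Finset.mem_coe] at hac hac'
    rcases Sym2.eq_iff.1 h with h | h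
    · exact Prod.ext h.1 h.2
    · exact absurd h.1 (hne _ hac.1 _ hac'.2)
  have hTdiag : (T : Set (Sym2 V)) ⊆ Sym2.diagSetᶜ := by
    intro e he
    obtain ⟨⟨a, c⟩, hac, rfl⟩ := Finset.mem_image.1 (Finset.mem_coe.1 he)
    rw [Finset.mem_product] at hac
    simpa using hne a hac.1 c hac.2
  rw [SimpleGraph.binomialRandom_apply', ← hTcard]
  refine (measure_mono ?_).trans (setBernoulli_disjoint_le _ p T hTdiag)
  rintro _ ⟨G, hG, rfl⟩ e he
  obtain ⟨⟨a, c⟩, hac, rfl⟩ := Finset.mem_image.1 he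
  rw [Finset.mem_product] at hac
  exact hG.2 a hac.1 c hac.2

/-- The union bound over all pairs of sets of sizes `a` and `c`. The exponent `s` is left free so
that sets of nearly `n` vertices can be counted by their complements. -/
lemma binomialRandom_exists_isEmptyPair_le (n : ℕ) (p : unitInterval) (a c s : ℕ)
    (hc : n.choose c ≤ n ^ s) :
    SimpleGraph.binomialRandom (Fin n) p
        {G | ∃ A C : Finset (Fin n), A.card = a ∧ C.card = c ∧ IsEmptyPair G A C}
      ≤ ENNReal.ofReal ((n : ℝ) ^ (a + s) * (1 - p : ℝ) ^ (a * c)) := by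
  set I := Finset.powersetCard a (Finset.univ : Finset (Fin n)) ×ˢ
    Finset.powersetCard c (Finset.univ : Finset (Fin n)) with hI
  have hp : (0 : ℝ) ≤ 1 - p := sub_nonneg.2 p.2.2
  calc _ ≤ SimpleGraph.binomialRandom (Fin n) p (⋃ x ∈ I, {G | IsEmptyPair G x.1 x.2}) := by
        refine measure_mono ?_
        rintro G ⟨A, C, hA, hC, hG⟩
        simp only [Set.mem_iUnion]
        exact ⟨(A, C), by simp [hI, hA, hC], hG⟩
    _ ≤ ∑ x ∈ I, SimpleGraph.binomialRandom (Fin n) p {G | IsEmptyPair G x.1 x.2} :=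
        measure_biUnion_finset_le _ _
    _ ≤ ∑ x ∈ I, ENNReal.ofReal ((1 - p : ℝ) ^ (a * c)) := by
        refine Finset.sum_le_sum fun x hx => ?_
        simp only [hI, Finset.mem_product, Finset.mem_powersetCard_univ] at hx
        rw [← hx.1, ← hx.2]
        exact binomialRandom_isEmptyPair_le p _ _
    _ = ENNReal.ofReal (I.card * (1 - p : ℝ) ^ (a * c)) := by
        rw [Finset.sum_const, nsmul_eq_mul, ENNReal.ofReal_mul (by positivity),
          ENNReal.ofReal_natCast]
    _ ≤ _ := by
        refine ENNReal.ofReal_le_ofReal (mul_le_mul_of_nonneg_right ?_ (by positivity))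
        have hcard : I.card ≤ n ^ (a + s) := by
          simp only [hI, Finset.card_product, Finset.card_powersetCard, Finset.card_univ,
            Fintype.card_fin, pow_add]
          exact Nat.mul_le_mul (Nat.choose_le_pow n a) hc
        exact_mod_cast hcard

/-- An exponent surplus of `2 log n` makes a union-bound term at most `n⁻²`. -/
lemma natCast_pow_mul_one_sub_pow_le {n s t : ℕ} {p : ℝ} (hn : 0 < n) (hp : p ≤ 1)
    (h : (s + 2) * Real.log n ≤ p * t) : (n : ℝ) ^ s * (1 - p) ^ t ≤ 1 / (n : ℝ) ^ 2 := by
  have hn' : (0 : ℝ) < n := by exact_mod_cast hn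
  have hpow : ∀ k : ℕ, (n : ℝ) ^ k = Real.exp (k * Real.log n) := fun k => by
    rw [Real.exp_nat_mul, Real.exp_log hn']
  have hexp : (1 - p) ^ t ≤ Real.exp (-(p * t)) := by
    calc (1 - p) ^ t ≤ Real.exp (-p) ^ t :=
          pow_le_pow_left₀ (sub_nonneg.2 hp) (Real.one_sub_le_exp_neg p) t
      _ = Real.exp (-(p * t)) := by rw [← Real.exp_nat_mul]; ring_nf
  calc (n : ℝ) ^ s * (1 - p) ^ t ≤ Real.exp (s * Real.log n) * Real.exp (-(p * t)) := by
        rw [hpow s]; gcongr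
    _ ≤ Real.exp (-((2 : ℕ) * Real.log n)) := by
        rw [← Real.exp_add]
        refine Real.exp_le_exp.2 ?_
        push_cast
        linarith
    _ = 1 / (n : ℝ) ^ 2 := by rw [Real.exp_neg, hpow 2, one_div]

/-! ### Expansion of the random graph -/

/-- A set whose closed neighbourhood does not double has no edges to `n - 2 |A|` vertices outside
that neighbourhood. -/
lemma two_mul_card_le_card_closedNeighborhood {n m : ℕ} {G : SimpleGraph (Fin n)}
    (hm : 2 * m ≤ n)
    (h : ∀ a ∈ Finset.Icc 1 m,
      ¬ ∃ A C : Finset (Fin n), A.card = a ∧ C.card = n - 2 * a ∧ IsEmptyPair G A C)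
    (A : Finset (Fin n)) (hA : A.card ≤ m) : 2 * A.card ≤ (closedNeighborhood G A).card := by
  by_contra! hlt
  have hcompl : n - 2 * A.card ≤ (closedNeighborhood G A)ᶜ.card := by
    rw [Finset.card_compl, Fintype.card_fin]; omega
  obtain ⟨C, hC, hCcard⟩ := Finset.exists_subset_card_eq hcompl
  refine h A.card (Finset.mem_Icc.2 ⟨by omega, hA⟩) ⟨A, C, rfl, hCcard, ?_, ?_⟩
  · exact Finset.disjoint_right.2 fun v hv hvA =>
      Finset.mem_compl.1 (hC hv) (subset_closedNeighborhood A hvA)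
  · exact fun a ha c hc hac =>
      Finset.mem_compl.1 (hC hc) (mem_closedNeighborhood.2 (Or.inr ⟨a, ha, hac⟩))

/-- The probability that `G(n, p)` fails to expand at a scale `m ≥ 4 log n / p`. -/
lemma binomialRandom_exists_isEmptyPair_scale_le {n m : ℕ} (p : unitInterval) (hm : 0 < m)
    (hmn : 4 * m ≤ n) (hpm : 4 * Real.log n ≤ p * m) (hpn : 10 * Real.log n ≤ p * n) :
    SimpleGraph.binomialRandom (Fin n) p
        ({G | ∃ A C : Finset (Fin n), A.card = m ∧ C.card = m ∧ IsEmptyPair G A C} ∪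
          ⋃ a ∈ Finset.Icc 1 m, {G | ∃ A C : Finset (Fin n),
            A.card = a ∧ C.card = n - 2 * a ∧ IsEmptyPair G A C})
      ≤ ENNReal.ofReal (1 / n) := by
  have hn : 0 < n := by omega
  have hlog : 0 ≤ Real.log n := Real.log_natCast_nonneg n
  have hp : (0 : ℝ) ≤ p := p.2.1
  have hlarge : SimpleGraph.binomialRandom (Fin n) p
      {G | ∃ A C : Finset (Fin n), A.card = m ∧ C.card = m ∧ IsEmptyPair G A C}
        ≤ ENNReal.ofReal (1 / (n : ℝ) ^ 2) := by
    refine (binomialRandom_exists_isEmptyPair_le n p m m m (Nat.choose_le_pow n m)).trans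
      (ENNReal.ofReal_le_ofReal (natCast_pow_mul_one_sub_pow_le hn p.2.2 ?_))
    have hm1 : (1 : ℝ) ≤ m := by exact_mod_cast hm
    push_cast
    nlinarith [mul_le_mul_of_nonneg_right hpm (Nat.cast_nonneg m : (0 : ℝ) ≤ m),
      mul_le_mul_of_nonneg_right hm1 hlog]
  have hsmall : ∀ a ∈ Finset.Icc 1 m, SimpleGraph.binomialRandom (Fin n) p
      {G | ∃ A C : Finset (Fin n), A.card = a ∧ C.card = n - 2 * a ∧ IsEmptyPair G A C}
        ≤ ENNReal.ofReal (1 / (n : ℝ) ^ 2) := by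
    intro a ha
    obtain ⟨ha1, ham⟩ := Finset.mem_Icc.1 ha
    refine (binomialRandom_exists_isEmptyPair_le n p a (n - 2 * a) (2 * a) ?_).trans
      (ENNReal.ofReal_le_ofReal (natCast_pow_mul_one_sub_pow_le hn p.2.2 ?_))
    · rw [Nat.choose_symm (by omega)]
      exact Nat.choose_le_pow n (2 * a)
    · have ha1' : (1 : ℝ) ≤ a := by exact_mod_cast ha1
      have hhalf : (n : ℝ) ≤ 2 * (n - 2 * a : ℕ) := by
        have : n ≤ 2 * (n - 2 * a) := by omega
        exact_mod_cast this
      -- `n - 2a ≥ n / 2` makes the exponent at least `a p n / 2 ≥ 5 a log n`.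
      have hexponent : 5 * Real.log n ≤ p * (n - 2 * a : ℕ) := by
        nlinarith [mul_le_mul_of_nonneg_left hhalf hp]
      rw [Nat.cast_mul]
      push_cast [-Nat.cast_sub] at hexponent ⊢
      nlinarith [mul_le_mul_of_nonneg_left hexponent (by positivity : (0 : ℝ) ≤ a),
        mul_le_mul_of_nonneg_right ha1' hlog]
  calc _ ≤ ENNReal.ofReal (1 / (n : ℝ) ^ 2) +
        ∑ a ∈ Finset.Icc 1 m, ENNReal.ofReal (1 / (n : ℝ) ^ 2) :=
        (measure_union_le _ _).trans (add_le_add hlarge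
          ((measure_biUnion_finset_le _ _).trans (Finset.sum_le_sum hsmall)))
    _ = ENNReal.ofReal ((1 + m) * (1 / (n : ℝ) ^ 2)) := by
        rw [Finset.sum_const, Nat.card_Icc, Nat.add_sub_cancel, nsmul_eq_mul, add_mul, one_mul,
          ENNReal.ofReal_add (by positivity) (by positivity), ENNReal.ofReal_mul (by positivity),
          ENNReal.ofReal_natCast]
    _ ≤ ENNReal.ofReal (1 / n) := by
        refine ENNReal.ofReal_le_ofReal ?_
        have hn' : (0 : ℝ) < n := by exact_mod_cast hn
        have hle : (1 + m : ℝ) ≤ n := by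
          have : 1 + m ≤ n := by omega
          exact_mod_cast this
        calc (1 + m : ℝ) * (1 / (n : ℝ) ^ 2) ≤ (n : ℝ) * (1 / (n : ℝ) ^ 2) := by gcongr
          _ = 1 / (n : ℝ) := by field_simp

end Probability

/-! ### Choice of the scale -/

/-- The scale at which `G(n, p)` expands, `⌈4 log n / p⌉ + 1`; the summand `1` keeps it
positive. -/
noncomputable def expansionScale (n : ℕ) (p : ℝ) : ℕ := ⌈4 * Real.log n / p⌉₊ + 1

lemma tendsto_expansionScale_div {p : ℕ → unitInterval}
    (hlow : Tendsto (fun n : ℕ => (p n : ℝ) / (Real.log n / n)) atTop atTop) :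
    Tendsto (fun n : ℕ => (expansionScale n (p n) : ℝ) / n) atTop (𝓝 0) := by
  have hbound : Tendsto (fun n : ℕ => 4 * ((p n : ℝ) / (Real.log n / n))⁻¹ + 2 / (n : ℝ))
      atTop (𝓝 0) := by
    simpa using (hlow.inv_tendsto_atTop.const_mul 4).add
      (tendsto_const_div_atTop_nhds_zero_nat (2 : ℝ))
  refine squeeze_zero (fun n => by positivity) (fun n => ?_) hbound
  have hp : (0 : ℝ) ≤ p n := (p n).2.1
  have hceil := (Nat.ceil_lt_add_one
    (div_nonneg (mul_nonneg zero_le_four (Real.log_natCast_nonneg n)) hp)).le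
  calc (expansionScale n (p n) : ℝ) / n ≤ (4 * Real.log n / p n + 2) / n := by
        gcongr
        rw [expansionScale]
        push_cast
        linarith
    _ = _ := by rw [inv_div]; ring

theorem mainTheorem9 (p : ℕ → unitInterval)
    (hlow : Tendsto (fun n : ℕ => (p n : ℝ) / (Real.log n / n)) atTop atTop)
    (hup : ∀ᶠ n : ℕ in atTop, (p n : ℝ) ≤ Real.log n ^ 10 / n) :
    ∃ ε : ℕ → ℝ, (ε =o[atTop] fun n : ℕ => (n : ℝ)) ∧
      HoldsWhp p fun n G =>
        ∀ S : Finset (Fin n), Even S.card →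
          ∃ E₀ : Finset (Sym2 (Fin n)), (E₀ : Set (Sym2 (Fin n))) ⊆ G.edgeSet ∧
            oddVertices E₀ = S ∧ |(E₀.card : ℝ) - (S.card : ℝ) / 2| ≤ ε n := by
  have hscale := tendsto_expansionScale_div hlow
  refine ⟨fun n => 4 * expansionScale n (p n), ?_, ?_⟩
  · refine IsLittleO.const_mul_left ?_ 4
    refine (isLittleO_iff_tendsto' ?_).2 hscale
    filter_upwards [eventually_gt_atTop 0] with n hn h
    exact absurd (Nat.cast_eq_zero.1 h) hn.ne'
  have hlower : Tendsto (fun n : ℕ => 1 - ENNReal.ofReal (1 / n)) atTop (𝓝 1) := by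
    have h : Tendsto (fun n : ℕ => ENNReal.ofReal (1 / n)) atTop (𝓝 0) := by
      simpa using ENNReal.tendsto_ofReal (tendsto_const_div_atTop_nhds_zero_nat (1 : ℝ))
    simpa using ENNReal.Tendsto.sub tendsto_const_nhds h (Or.inl ENNReal.one_ne_top)
  refine tendsto_of_tendsto_of_tendsto_of_le_of_le' hlower tendsto_const_nhds ?_
    (Eventually.of_forall fun n => MeasureTheory.prob_le_one)
  filter_upwards [eventually_ge_atTop 2, hlow.eventually_ge_atTop 10,
    hscale.eventually_le_const (show (0 : ℝ) < 1 / 4 by norm_num)] with n hn hpn hmn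
  have hn0 : (0 : ℝ) < n := by positivity
  have hlog : 0 < Real.log n := Real.log_pos (by exact_mod_cast hn)
  rw [le_div_iff₀ (by positivity)] at hpn
  have hp : (0 : ℝ) < p n := lt_of_lt_of_le (by positivity) hpn
  have hpn' : 10 * Real.log n ≤ p n * n := by
    rwa [← mul_div_assoc, div_le_iff₀ hn0] at hpn
  have hmn' : 4 * expansionScale n (p n) ≤ n := by
    rw [div_le_iff₀ hn0] at hmn
    have : (4 * expansionScale n (p n) : ℝ) ≤ n := by linarith
    exact_mod_cast this
  have hpm : 4 * Real.log n ≤ p n * expansionScale n (p n) := by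
    rw [mul_comm (p n : ℝ), ← div_le_iff₀ hp, expansionScale]
    push_cast
    linarith [Nat.le_ceil (4 * Real.log n / (p n : ℝ))]
  have hbad := binomialRandom_exists_isEmptyPair_scale_le (p n) (Nat.succ_pos _) hmn' hpm hpn'
  refine (tsub_le_tsub_left hbad 1).trans (tsub_le_iff_right.2 ?_)
  rw [← MeasureTheory.measure_univ (μ := SimpleGraph.binomialRandom (Fin n) (p n))]
  refine (MeasureTheory.measure_mono fun G _ => ?_).trans (MeasureTheory.measure_union_le _ _)
  by_cases hG : G ∈ ({G | ∃ A C : Finset (Fin n), A.card = expansionScale n (p n) ∧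
      C.card = expansionScale n (p n) ∧ IsEmptyPair G A C} ∪
        ⋃ a ∈ Finset.Icc 1 (expansionScale n (p n)), {G | ∃ A C : Finset (Fin n),
          A.card = a ∧ C.card = n - 2 * a ∧ IsEmptyPair G A C} : Set (SimpleGraph (Fin n)))
  · exact Or.inr hG
  · refine Or.inl fun S hS => ?_
    simp only [Set.mem_union, Set.mem_iUnion, not_or, not_exists] at hG
    refine exists_abs_card_sub_le_of_expansion
      (two_mul_card_le_card_closedNeighborhood (by omega) ?_) ?_ S hS
    · rintro a ha ⟨A, C, h⟩
      exact hG.2 a ha ⟨A, C, h⟩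
    · intro A C hA hC hAC
      by_contra! h
      exact hG.1 ⟨A, C, hA, hC, hAC, h⟩
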